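/- Let $p$ be a prime, let $n$ be a positive integer with $n\ge 2$ if $p=2$, and let $k\ge 0$. Let $K/F$ be a Galois extension of fields whose group $G=\mathrm{Gal}(K/F)$ is isomorphic to $\mathbb{Z}/p^n\mathbb{Z}$. Let $L/K$ be an elementary $p$-abelian extension (Galois, with abelian Galois group of exponent dividing $p$) such that $L/F$ is Galois. Let $J$ be the space that parametrizes the elementary $p$-abelian extensions of $K$, and let $N\subseteq J$ be the $\mathbb{F}_p[G]$-submodule corresponding to $L$; that is: (i) if $K$ contains a primitive $p$-th root of unity, then $J=K^\times/K^{\times p}$ with the natural $G$-action, and $L=K(\sqrt[p]{\gamma}:\gamma\in N)$; (ii) if $\mathrm{char}\,K\ne p$ (whether or not $K$ contains a primitive $p$-th root of unity $\xi_p$), put $E=K(\xi_p)$; then $J\subseteq E^\times/E^{\times p}$ consists of the classes $\gamma$ such that $\varepsilon(\gamma)=\gamma^{t}$ whenever $\varepsilon\in\mathrm{Gal}(E/K)$ and $\varepsilon(\zeta)=\zeta^t$ for all $p$-th roots of unity $\zeta$; an element $g\in G$ acts on $J$ through the unique extension of $g$ to an automorphism of $E$ that fixes the $p$-th roots of unity;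 and $L(\xi_p)=E(\sqrt[p]{\gamma}:\gamma\in N)$; (iii) if $\mathrm{char}\,K=p$, then $J=K/\wp(K)$, where $\wp(K)=\{x^p-x: x\in K\}$, with the natural $G$-action, and $L=K(\rho(\gamma):\gamma\in N)$, where $\rho(\gamma)$ is a root of $X^p-X-\gamma$. In each of these settings, if $N\cong\mathbb{F}_p[G]^k$ as $\mathbb{F}_p[G]$-modules, then $\mathrm{Gal}(L/F)\cong\mathbb{F}_p[G]^k\rtimes G$, where $G$ acts on $\mathbb{F}_p[G]^k$ by left multiplication in each coordinate. -/

import Mathlib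

open scoped MonoidAlgebra

noncomputable section

/-- `L / K` is an elementary `p`-abelian extension: it is Galois, and its Galois group is abelian
of exponent dividing `p`. -/
structure IsElementaryAbelianExt (p : ℕ) (K L : Type*) [Field K] [Field L] [Algebra K L] :
    Prop where
  isGalois : IsGalois K L
  comm : ∀ s t : Gal(L/K), s * t = t * s
  pow_eq_one : ∀ s : Gal(L/K), s ^ p = 1

/-! ### The semidirect product `𝔽_p[G]^k ⋊ G` -/

/-- `G` acts on `𝔽_p[G]^k` by left multiplication in each coordinate. -/
def freeModuleAction (p k : ℕ) (G : Type*) [Group G] :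
    G →* MulAut (Multiplicative (Fin k → (ZMod p)[G])) where
  toFun g := AddEquiv.toMultiplicative
    { toFun := fun v i => MonoidAlgebra.of (ZMod p) G g * v i
      invFun := fun v i => MonoidAlgebra.of (ZMod p) G g⁻¹ * v i
      left_inv := fun v => by
        funext i
        dsimp only
        rw [← mul_assoc, ← map_mul, inv_mul_cancel, map_one, one_mul]
      right_inv := fun v => by
        funext i
        dsimp only
        rw [← mul_assoc, ← map_mul, mul_inv_cancel, map_one, one_mul]
      map_add' := fun v w => by
        funext i
        simp only [Pi.add_apply, mul_add] }
  map_one' := by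
    refine MulEquiv.ext fun v => ?_
    apply Multiplicative.toAdd.injective
    funext i
    exact (congrArg (· * v.toAdd i) (map_one (MonoidAlgebra.of (ZMod p) G))).trans (one_mul _)
  map_mul' g h := by
    refine MulEquiv.ext fun v => ?_
    apply Multiplicative.toAdd.injective
    funext i
    exact (congrArg (· * v.toAdd i) (map_mul (MonoidAlgebra.of (ZMod p) G) g h)).trans
      (mul_assoc _ _ _)

/-- The group `𝔽_p[G]^k ⋊ G`. -/
abbrev FreeSemidirect (p k : ℕ) (G : Type*) [Group G] : Type _ :=
  Multiplicative (Fin k → (ZMod p)[G]) ⋊[freeModuleAction p k G] G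

/-! ### Characteristic `p`: the space `K / ℘(K)` -/

section ArtinSchreier

variable (p : ℕ) [Fact p.Prime]

/-- The additive map `x ↦ x ^ p - x` on a field of characteristic `p`. -/
def wp (K : Type*) [Field K] [CharP K p] : K →+ K where
  toFun x := x ^ p - x
  map_zero' := by simp [(Fact.out : p.Prime).ne_zero]
  map_add' x y := by rw [add_pow_char]; ring

/-- `K / ℘(K)`. -/
abbrev ASClasses (K : Type*) [Field K] [CharP K p] : Type _ := K ⧸ (wp p K).range

instance ASClasses.module (K : Type*) [Field K] [CharP K p] : Module (ZMod p) (ASClasses p K) :=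
  QuotientAddGroup.zmodModule fun x => by
    rw [nsmul_eq_mul, CharP.cast_eq_zero, zero_mul]; exact zero_mem _

/-- The action of `Gal(K/F)` on `K / ℘(K)`. -/
def asRep (F K : Type*) [Field F] [Field K] [Algebra F K] [CharP K p] :
    Representation (ZMod p) Gal(K/F) (ASClasses p K) where
  toFun g := AddMonoidHom.toZModLinearMap p <|
    QuotientAddGroup.map (wp p K).range (wp p K).range (g : K →+ K) <| by
      rintro _ ⟨x, rfl⟩
      exact ⟨g x, by simp [wp]⟩
  map_one' := by
    ext x
    induction x using QuotientAddGroup.induction_on with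
    | H x => rfl
  map_mul' g h := by
    ext x
    induction x using QuotientAddGroup.induction_on with
    | H x => rfl

/-- `L = K(ρ(γ) : γ ∈ S)`, where `ρ(γ)` is a root of `X ^ p - X - γ`. -/
def IsASExtOf {K : Type*} (L : Type*) [Field K] [Field L] [Algebra K L] [CharP K p]
    (S : Set (ASClasses p K)) : Prop :=
  (∀ a : K, (QuotientAddGroup.mk a : ASClasses p K) ∈ S →
    ∃ x : L, x ^ p - x = algebraMap K L a) ∧
  IntermediateField.adjoin K {x : L | ∃ a : K, (QuotientAddGroup.mk a : ASClasses p K) ∈ S ∧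
    x ^ p - x = algebraMap K L a} = ⊤

end ArtinSchreier

/-! ### Characteristic different from `p`: the space `E^× / E^{×p}` -/

section Kummer

variable (p : ℕ)

/-- `E^× / E^{×p}`, written additively. -/
def PowerClasses (E : Type*) [Field E] : Type _ :=
  Additive (Eˣ ⧸ (powMonoidHom p : Eˣ →* Eˣ).range)

instance PowerClasses.addCommGroup (E : Type*) [Field E] : AddCommGroup (PowerClasses p E) :=
  inferInstanceAs (AddCommGroup (Additive (Eˣ ⧸ (powMonoidHom p : Eˣ →* Eˣ).range)))

/-- The class of a unit in `E^× / E^{×p}`. -/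
def PowerClasses.mk {E : Type*} [Field E] (u : Eˣ) : PowerClasses p E :=
  Additive.ofMul (QuotientGroup.mk u : Eˣ ⧸ (powMonoidHom p : Eˣ →* Eˣ).range)

theorem PowerClasses.mk_surjective {E : Type*} [Field E] (γ : PowerClasses p E) :
    ∃ u : Eˣ, PowerClasses.mk p u = γ :=
  QuotientGroup.mk_surjective (s := (powMonoidHom p : Eˣ →* Eˣ).range) γ

instance PowerClasses.module (E : Type*) [Field E] : Module (ZMod p) (PowerClasses p E) :=
  AddCommGroup.zmodModule fun x => by
    obtain ⟨u, rfl⟩ := PowerClasses.mk_surjective p x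
    exact (QuotientGroup.eq_one_iff (N := (powMonoidHom p : Eˣ →* Eˣ).range) (u ^ p)).2 ⟨u, rfl⟩

/-- The map on `E^× / E^{×p}` induced by an element of `Gal(E/F)`. -/
def powerMap (F E : Type*) [Field F] [Field E] [Algebra F E] (g : Gal(E/F)) :
    PowerClasses p E →+ PowerClasses p E :=
  MonoidHom.toAdditive <|
    QuotientGroup.map (powMonoidHom p : Eˣ →* Eˣ).range (powMonoidHom p : Eˣ →* Eˣ).range
      (Units.map (g : E →* E)) <| by
        rintro _ ⟨x, rfl⟩
        exact ⟨Units.map (g : E →* E) x, by simp⟩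

/-- The action of `Gal(E/F)` on `E^× / E^{×p}`. -/
def powerRep (F E : Type*) [Field F] [Field E] [Algebra F E] :
    Representation (ZMod p) Gal(E/F) (PowerClasses p E) where
  toFun g := AddMonoidHom.toZModLinearMap p (powerMap p F E g)
  map_one' := by
    ext x
    obtain ⟨u, rfl⟩ := PowerClasses.mk_surjective p x
    rfl
  map_mul' g h := by
    ext x
    obtain ⟨u, rfl⟩ := PowerClasses.mk_surjective p x
    rfl

theorem powerRep_mk {F E : Type*} [Field F] [Field E] [Algebra F E] (g : Gal(E/F)) (u : Eˣ) :
    powerRep p F E g (PowerClasses.mk p u) = PowerClasses.mk p (Units.map (g : E →* E) u) := rfl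

/-- `M = E(γ^{1/p} : γ ∈ S)`. -/
def IsKummerExtOf {E : Type*} (M : Type*) [Field E] [Field M] [Algebra E M]
    (S : Set (PowerClasses p E)) : Prop :=
  (∀ u : Eˣ, PowerClasses.mk p u ∈ S → ∃ x : M, x ^ p = algebraMap E M u) ∧
  IntermediateField.adjoin E {x : M | ∃ u : Eˣ, PowerClasses.mk p u ∈ S ∧
    x ^ p = algebraMap E M u} = ⊤

/-- For `E = K(ξ_p)`, the subspace of `E^× / E^{×p}` which parametrizes the elementary `p`-abelian
extensions of `K`: the classes `γ` such that `ε(γ) = γ ^ t` whenever `ε ∈ Gal(E/K)` acts on the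
`p`-th roots of unity by `ζ ↦ ζ ^ t`. It is everything if `ξ_p ∈ K`. -/
def cycSpace (K E : Type*) [Field K] [Field E] [Algebra K E] :
    Submodule (ZMod p) (PowerClasses p E) where
  carrier := {γ | ∀ (ε : Gal(E/K)) (t : ℕ), (∀ ζ : E, ζ ^ p = 1 → ε ζ = ζ ^ t) →
    powerRep p K E ε γ = (t : ZMod p) • γ}
  add_mem' := fun ha hb ε t h => by rw [map_add, ha ε t h, hb ε t h, smul_add]
  zero_mem' := fun ε t _ => by rw [map_zero, smul_zero]
  smul_mem' := fun c x hx ε t h => by rw [map_smul, hx ε t h, smul_comm]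

variable [Fact p.Prime] {n : ℕ} {F K : Type*} (E : Type*) [Field F] [Field K] [Field E]
  [Algebra F K] [Algebra F E] [Algebra K E]

/-- `h ∈ Gal(E/F)` extends `g ∈ Gal(K/F)` and fixes the `p`-th roots of unity. -/
def ExtendsFixingRoots (g : Gal(K/F)) (h : Gal(E/F)) : Prop :=
  (∀ x : K, h (algebraMap K E x) = algebraMap K E (g x)) ∧ ∀ ζ : E, ζ ^ p = 1 → h ζ = ζ

variable {E} in
theorem ExtendsFixingRoots.unique [IsCyclotomicExtension {p} K E] {g : Gal(K/F)} {h h' : Gal(E/F)}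
    (H : ExtendsFixingRoots p E g h) (H' : ExtendsFixingRoots p E g h') : h = h' := by
  ext x
  have hx := IsCyclotomicExtension.adjoin_roots (S := {p}) (A := K) (B := E) x
  induction hx using Algebra.adjoin_induction with
  | mem y hy =>
    obtain ⟨m, hm, -, hy⟩ := hy
    rw [Set.mem_singleton_iff] at hm
    subst hm
    rw [H.2 y hy, H'.2 y hy]
  | algebraMap r => rw [H.1, H'.1]
  | add a b _ _ ha hb => rw [map_add, map_add, ha, hb]
  | mul a b _ _ ha hb => rw [map_mul, map_mul, ha, hb]

variable [IsScalarTower F K E]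

theorem exists_extendsFixingRoots [FiniteDimensional F K] [IsGalois F K]
    [IsCyclotomicExtension {p} K E]
    (hG : Nonempty (Gal(K/F) ≃* Multiplicative (ZMod (p ^ n)))) (g : Gal(K/F)) :
    ∃ h : Gal(E/F), ExtendsFixingRoots p E g h := by
  have hp : p.Prime := Fact.out
  have : NeZero p := ⟨hp.ne_zero⟩
  obtain ⟨ζ₀, hζ₀⟩ := IsCyclotomicExtension.exists_isPrimitiveRoot (S := {p}) K E
    (Set.mem_singleton p) hp.ne_zero
  -- `E / F` is normal
  obtain ⟨f, hf0, hf⟩ : ∃ f : Polynomial F, f ≠ 0 ∧ Polynomial.IsSplittingField F K f := by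
    obtain ⟨f, hf⟩ := Normal.exists_isSplittingField F K
    by_cases hf0 : f = 0
    · refine ⟨1, one_ne_zero, ⟨by simp, ?_⟩⟩
      have := hf.adjoin_rootSet
      rw [hf0] at this
      simpa using this
    · exact ⟨f, hf0, hf⟩
  have : Polynomial.IsSplittingField K E
      (((Polynomial.X : Polynomial F) ^ p - 1).map (algebraMap F K)) := by
    have := IsCyclotomicExtension.isSplittingField_X_pow_sub_one p K E
    simpa using this
  have hsp := Polynomial.IsSplittingField.mul (K := K) E f
    ((Polynomial.X : Polynomial F) ^ p - 1) hf0
    (Polynomial.X_pow_sub_C_ne_zero hp.pos 1)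
  have : Normal F E := Normal.of_isSplittingField (f * (Polynomial.X ^ p - 1))
  -- correct an arbitrary extension of `g` by a suitable power
  have hco : Nat.Coprime (p ^ n) (p - 1) := by
    apply Nat.Coprime.pow_left
    rw [Nat.Prime.coprime_iff_not_dvd hp]
    intro hd
    have := hp.two_le
    have := Nat.le_of_dvd (by omega) hd
    omega
  obtain ⟨m, hm1, hm2⟩ := Nat.chineseRemainder hco 1 0
  have hgord : g ^ (p ^ n) = 1 := by
    obtain ⟨e⟩ := hG
    apply e.injective
    rw [map_pow, map_one]
    apply Multiplicative.toAdd.injective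
    rw [toAdd_pow, toAdd_one, nsmul_eq_mul, CharP.cast_eq_zero, zero_mul]
  have hgm : g ^ m = g := by
    have := pow_eq_pow_iff_modEq.2 (hm1.of_dvd (orderOf_dvd_of_pow_eq_one hgord))
    rwa [pow_one] at this
  set h := AlgEquiv.liftNormal g E with hh
  have hpow : ∀ (j : ℕ) (x : K), (h ^ j) (algebraMap K E x) = algebraMap K E ((g ^ j) x) := by
    intro j
    induction j with
    | zero => intro x; rfl
    | succ j ih =>
      intro x
      rw [pow_succ, pow_succ, AlgEquiv.mul_apply, AlgEquiv.mul_apply, hh,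
        AlgEquiv.liftNormal_commutes, ← hh, ih]
  refine ⟨h ^ m, fun x => by rw [hpow, hgm], fun ζ hζ => ?_⟩
  obtain ⟨i, -, hi⟩ := hζ₀.eq_pow_of_pow_eq_one (ξ := h ζ₀) (by
    rw [← map_pow, hζ₀.pow_eq_one, map_one])
  have hact : ∀ (j : ℕ) (ζ : E), ζ ^ p = 1 → (h ^ j) ζ = ζ ^ (i ^ j) := by
    intro j
    induction j with
    | zero => intro ζ _; rw [pow_zero, pow_zero, pow_one]; rfl
    | succ j ih =>
      intro ζ hζ
      obtain ⟨l, -, rfl⟩ := hζ₀.eq_pow_of_pow_eq_one hζ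
      rw [pow_succ, AlgEquiv.mul_apply, map_pow, ← hi, map_pow, map_pow, ih ζ₀ hζ₀.pow_eq_one]
      simp only [← pow_mul]
      ring_nf
  rw [hact m ζ hζ]
  have hpi : ¬ p ∣ i := by
    rintro ⟨c, rfl⟩
    rw [pow_mul, hζ₀.pow_eq_one, one_pow] at hi
    have h1 : ζ₀ = 1 := h.injective (by rw [← hi, map_one])
    exact hζ₀.ne_one hp.one_lt h1
  obtain ⟨c, rfl⟩ := (Nat.modEq_zero_iff_dvd).1 hm2
  have hfer : i ^ ((p - 1) * c) ≡ 1 [MOD p] := by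
    have := Nat.ModEq.pow_totient ((Nat.Prime.coprime_iff_not_dvd hp).2 hpi).symm
    rw [Nat.totient_prime hp] at this
    simpa [pow_mul] using this.pow c
  rw [pow_eq_pow_mod _ hζ, hfer, ← pow_eq_pow_mod _ hζ, pow_one]

/-- The extension of the action of `Gal(K/F)` to `E = K(ξ_p)`: each `g` acts on `E` by the unique
extension of `g` that fixes the `p`-th roots of unity. -/
def cycLift [FiniteDimensional F K] [IsGalois F K] [IsCyclotomicExtension {p} K E]
    (hG : Nonempty (Gal(K/F) ≃* Multiplicative (ZMod (p ^ n)))) : Gal(K/F) →* Gal(E/F) where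
  toFun g := (exists_extendsFixingRoots p E hG g).choose
  map_one' := (exists_extendsFixingRoots p E hG 1).choose_spec.unique p
    ⟨fun _ => rfl, fun _ _ => rfl⟩
  map_mul' g g' := by
    have h := (exists_extendsFixingRoots p E hG g).choose_spec
    have h' := (exists_extendsFixingRoots p E hG g').choose_spec
    refine (exists_extendsFixingRoots p E hG (g * g')).choose_spec.unique p ⟨fun x => ?_, ?_⟩
    · rw [AlgEquiv.mul_apply, h'.1, h.1, AlgEquiv.mul_apply]
    · intro ζ hζ
      rw [AlgEquiv.mul_apply, h'.2 ζ hζ, h.2 ζ hζ]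

theorem cycLift_spec [FiniteDimensional F K] [IsGalois F K] [IsCyclotomicExtension {p} K E]
    (hG : Nonempty (Gal(K/F) ≃* Multiplicative (ZMod (p ^ n)))) (g : Gal(K/F)) :
    ExtendsFixingRoots p E g (cycLift p E hG g) :=
  (exists_extendsFixingRoots p E hG g).choose_spec

theorem cycSpace_stable [FiniteDimensional F K] [IsGalois F K] [IsCyclotomicExtension {p} K E]
    (hG : Nonempty (Gal(K/F) ≃* Multiplicative (ZMod (p ^ n)))) (g : Gal(K/F)) :
    cycSpace p K E ≤ (cycSpace p K E).comap ((powerRep p F E).comp (cycLift p E hG) g) := by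
  intro γ hγ ε t ht
  obtain ⟨h1, h2⟩ := cycLift_spec p E hG g
  set h := cycLift p E hG g with hh
  have h1' : ∀ x : K, h.symm (algebraMap K E x) = algebraMap K E (g.symm x) := fun x => by
    rw [AlgEquiv.symm_apply_eq, h1, AlgEquiv.apply_symm_apply]
  have h2' : ∀ ζ : E, ζ ^ p = 1 → h.symm ζ = ζ := fun ζ hζ => by
    rw [AlgEquiv.symm_apply_eq, h2 ζ hζ]
  let ε' : Gal(E/K) := AlgEquiv.ofRingEquiv
    (f := ((h : E ≃+* E).trans (ε : E ≃+* E)).trans (h.symm : E ≃+* E)) (fun x => by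
      change h.symm (ε (h (algebraMap K E x))) = _
      rw [h1, AlgEquiv.commutes, h1', AlgEquiv.symm_apply_apply])
  have he : ∀ x, h (ε' x) = ε (h x) := fun x => h.apply_symm_apply _
  have key := hγ ε' t (fun ζ hζ => by
    change h.symm (ε (h ζ)) = _
    rw [h2 ζ hζ, ht ζ hζ, h2']
    rw [← pow_mul, mul_comm, pow_mul, hζ, one_pow])
  change powerRep p K E ε (powerRep p F E h γ) = (t : ZMod p) • powerRep p F E h γ
  rw [← map_smul, ← key]
  obtain ⟨u, rfl⟩ := PowerClasses.mk_surjective p γ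
  simp only [powerRep_mk]
  congr 1
  ext
  exact (he u).symm

/-- The action of `Gal(K/F)` on the parametrizing space `cycSpace p K E`, where `E = K(ξ_p)`. -/
def cycRep [FiniteDimensional F K] [IsGalois F K] [IsCyclotomicExtension {p} K E]
    (hG : Nonempty (Gal(K/F) ≃* Multiplicative (ZMod (p ^ n)))) :
    Representation (ZMod p) Gal(K/F) (cycSpace p K E) :=
  Representation.subrepresentation ((powerRep p F E).comp (cycLift p E hG)) (cycSpace p K E)
    (cycSpace_stable p E hG)

end Kummer

end

/-!
Kummer theory, resp. Artin–Schreier theory, pairs `A = Gal(L/K)` perfectly with `N`, and the pairing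
is equivariant up to the character through which `Gal(K/F)` acts on the `p`-th roots of unity. Since
`N` is free over `𝔽_p[G]`, its dual `A` is coinduced from the trivial group, the character being
absorbed by a rescaling of the coordinates. By Shapiro's lemma `H²(G, A) = 0`, hence `Gal(L/F)` is
the regular wreath product of `𝔽_p^k` by `G`, which is `𝔽_p[G]^k ⋊ G`. Concretely the isomorphism is
the Kaloujnine–Krasner embedding followed by evaluation at `1 ∈ G`.

If `ξ_p ∉ K`, the pairing is formed with the automorphisms of `L(ξ_p)` that restrict to a
prescribed lift of `Gal(K/F)` to `K(ξ_p)`.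
-/

section Wreath

variable {Γ G D : Type*} [Group Γ] [Group G] [Group D] {π : Γ →* G} {t : G → Γ}

/-- The `π.ker`-valued cocycle on `Γ` attached to a section `t` of `π`, from which the
Kaloujnine–Krasner embedding is built. -/
def sectionCocycle (ht : Function.RightInverse t π) (τ : Γ) (x : G) : π.ker :=
  ⟨(t x)⁻¹ * τ * t ((π τ)⁻¹ * x), by simp [MonoidHom.mem_ker, ht _]⟩

theorem sectionCocycle_mul (ht : Function.RightInverse t π) (τ ρ : Γ) (x : G) :
    sectionCocycle ht (τ * ρ) x =
      sectionCocycle ht τ x * sectionCocycle ht ρ ((π τ)⁻¹ * x) := by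
  ext
  simp [sectionCocycle, mul_assoc]

theorem sectionCocycle_coe (ht : Function.RightInverse t π) (σ : π.ker) (x : G) :
    sectionCocycle ht σ x = MulAut.conjNormal (t x)⁻¹ σ := by
  ext
  simp [sectionCocycle, MonoidHom.mem_ker.1 σ.2]

/-- The Kaloujnine–Krasner homomorphism from an extension of `G` by `π.ker` to the wreath product
`D ≀ᵣ G`, induced by a homomorphism `π.ker →* D`. -/
def kaloujnineKrasner (ht : Function.RightInverse t π) (f : π.ker →* D) : Γ →* D ≀ᵣ G :=
  MonoidHom.mk' (fun τ ↦ ⟨fun x ↦ f (sectionCocycle ht τ x), π τ⟩) fun τ ρ ↦ by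
    ext
    · simp [sectionCocycle_mul]
    · simp

/-- This is Shapiro's lemma in degree two: an extension of `G` by a coinduced module splits. -/
theorem nonempty_mulEquiv_regularWreathProduct (hπ : Function.Surjective π)
    (ψ : π.ker →* (G → D)) (hψ : Function.Bijective ψ)
    (hconj : ∀ τ σ x, ψ (MulAut.conjNormal τ σ) x = ψ σ ((π τ)⁻¹ * x)) :
    Nonempty (Γ ≃* D ≀ᵣ G) := by
  obtain ⟨t, ht⟩ := hπ.hasRightInverse
  let f : Γ →* D ≀ᵣ G := kaloujnineKrasner ht ((Pi.evalMonoidHom (fun _ ↦ D) 1).comp ψ)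
  have f_right (τ : Γ) : (f τ).right = π τ := rfl
  have f_ker (σ : π.ker) : (f σ).left = ψ σ := by
    funext x
    change ψ (sectionCocycle ht σ x) 1 = ψ σ x
    rw [sectionCocycle_coe, hconj, map_inv, ht, inv_inv, mul_one]
  refine ⟨MulEquiv.ofBijective f ⟨(injective_iff_map_eq_one f).2 fun τ hτ ↦ ?_, fun a ↦ ?_⟩⟩
  · have hτker : τ ∈ π.ker := by
      rw [MonoidHom.mem_ker, ← f_right, hτ, RegularWreathProduct.one_right]
    have hψτ : ψ ⟨τ, hτker⟩ = 1 := by rw [← f_ker, hτ, RegularWreathProduct.one_left]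
    exact congrArg Subtype.val ((map_eq_one_iff ψ hψ.1).1 hψτ)
  · obtain ⟨τ, hτ⟩ := hπ a.right
    obtain ⟨σ, hσ⟩ := hψ.2 (a * (f τ)⁻¹).left
    have hfσ : f σ = a * (f τ)⁻¹ := by
      ext1
      · rw [f_ker, hσ]
      · simp [f_right, hτ, MonoidHom.mem_ker.1 σ.2]
    exact ⟨σ * τ, by rw [map_mul, hfσ, inv_mul_cancel_right]⟩

variable (p k : ℕ)

theorem freeModuleAction_apply (g : G) (v : Multiplicative (Fin k → (ZMod p)[G])) (i : Fin k) :
    (freeModuleAction p k G g v).toAdd i = MonoidAlgebra.of (ZMod p) G g * v.toAdd i := rfl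

/-- For finite `G`, the free module `𝔽_p[G]^k` is coinduced, so that `𝔽_p[G]^k ⋊ G` is a wreath
product. -/
noncomputable def regularWreathProductEquivFreeSemidirect [Finite G] :
    Multiplicative (Fin k → ZMod p) ≀ᵣ G ≃* FreeSemidirect p k G where
  toFun a := ⟨.ofAdd fun i ↦ .ofCoeff (Finsupp.equivFunOnFinite.symm fun x ↦ (a.left x).toAdd i),
    a.right⟩
  invFun b := ⟨fun x ↦ .ofAdd fun i ↦ (b.left.toAdd i).coeff x, b.right⟩
  left_inv a := rfl
  right_inv b := by
    refine SemidirectProduct.ext (Multiplicative.toAdd.injective ?_) rfl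
    funext i
    ext x
    rfl
  map_mul' a b := by
    refine SemidirectProduct.ext (Multiplicative.toAdd.injective ?_) rfl
    funext i
    ext x
    simp [freeModuleAction_apply, MonoidAlgebra.coeff_single_mul_apply]

end Wreath

section Duality

theorem dual_surjective_of_separating {p : ℕ} [Fact p.Prime] {A V : Type*} [AddGroup A]
    [AddCommGroup V] [Module (ZMod p) V] [FiniteDimensional (ZMod p) V]
    (φ : A →+ Module.Dual (ZMod p) V) (hφ : ∀ v, (∀ a, φ a v = 0) → v = 0) :
    Function.Surjective φ := by
  set W : Submodule (ZMod p) (Module.Dual (ZMod p) V) := AddSubgroup.toZModSubmodule p φ.range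
  have hW : W.dualCoannihilator = ⊥ := by
    rw [Submodule.eq_bot_iff]
    exact fun v hv ↦ hφ v fun a ↦ (Submodule.mem_dualCoannihilator v).1 hv (φ a) ⟨a, rfl⟩
  have hW' : W = ⊤ := by
    rw [← Subspace.dualCoannihilator_dualAnnihilator_eq (W := W), hW,
      Submodule.dualAnnihilator_bot]
  exact fun f ↦ (hW' ▸ Submodule.mem_top : f ∈ W)

variable {R G : Type*} [CommSemiring R] (k : ℕ)

variable (R G) in
/-- The coordinates of a linear form on `R[G]^k`, for the basis of the elements of `G` in each
factor. -/
noncomputable def dualCoord : Module.Dual R (Fin k → R[G]) ≃+ (G → Fin k → R) where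
  toFun f x i := f (Pi.single i (.single x 1))
  invFun w := ∑ i, ((MonoidAlgebra.basis G R).constr R fun x ↦ w x i) ∘ₗ LinearMap.proj i
  left_inv f := by
    ext i x
    simp [Pi.single_apply, apply_ite, ← MonoidAlgebra.basis_apply, Module.Basis.constr_basis]
  right_inv w := by
    ext x i
    simp [Pi.single_apply, apply_ite, ← MonoidAlgebra.basis_apply, Module.Basis.constr_basis]
  map_add' _ _ := rfl

variable {k}

theorem of_smul_single [Group G] (g x : G) (i : Fin k) :
    MonoidAlgebra.of R G g • (Pi.single i (.single x 1) : Fin k → R[G]) =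
      Pi.single i (.single (g * x) 1) := by
  rw [← Pi.single_smul, MonoidAlgebra.of_apply, smul_eq_mul, MonoidAlgebra.single_mul_single,
    mul_one]

theorem nonempty_mulEquiv_freeSemidirect_of_dual {p : ℕ} {Γ : Type*} [Group Γ] [Group G]
    [Finite G] {π : Γ →* G} (hπ : Function.Surjective π) (χ : G →* (ZMod p)ˣ)
    (φ : Additive π.ker →+ Module.Dual (ZMod p) (Fin k → (ZMod p)[G])) (hφ : Function.Bijective φ)
    (hconj : ∀ τ σ v, φ (.ofMul (MulAut.conjNormal τ σ)) (MonoidAlgebra.of (ZMod p) G (π τ) • v) =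
      χ (π τ) * φ (.ofMul σ) v) :
    Nonempty (Γ ≃* FreeSemidirect p k G) := by
  let untwist : (G → Fin k → ZMod p) ≃+ (G → Fin k → ZMod p) :=
    AddEquiv.piCongrRight fun x ↦ DistribMulAction.toAddEquiv _ (χ x)⁻¹
  let coord : Additive π.ker →+ (G → Fin k → ZMod p) :=
    untwist.toAddMonoidHom.comp <| (dualCoord (ZMod p) G k).toAddMonoidHom.comp φ
  have coord_apply (σ : π.ker) (x : G) (i : Fin k) : coord (.ofMul σ) x i =
      ↑(χ x)⁻¹ * φ (.ofMul σ) (Pi.single i (.single x 1)) := rfl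
  let ψ : π.ker →* (G → Multiplicative (Fin k → ZMod p)) :=
    { toFun σ x := .ofAdd (coord (.ofMul σ) x)
      map_one' := congrArg (fun f x ↦ Multiplicative.ofAdd (f x)) (map_zero coord)
      map_mul' σ τ := congrArg (fun f x ↦ Multiplicative.ofAdd (f x)) (map_add coord _ _) }
  have hψ : Function.Bijective ψ :=
    untwist.bijective.comp <| (dualCoord (ZMod p) G k).bijective.comp hφ
  obtain ⟨e⟩ := nonempty_mulEquiv_regularWreathProduct hπ ψ hψ fun τ σ x ↦ by
    apply Multiplicative.toAdd.injective
    funext i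
    change coord (.ofMul (MulAut.conjNormal τ σ)) x i = coord (.ofMul σ) ((π τ)⁻¹ * x) i
    rw [coord_apply, coord_apply, ← mul_inv_cancel_left (π τ) x, ← of_smul_single, hconj]
    simp [mul_assoc]
  exact ⟨e.trans (regularWreathProductEquivFreeSemidirect p k)⟩

end Duality

section AbstractKummerTheory

variable {Γ G J B X : Type*} [Group Γ] [Group G] [AddCommGroup J] [AddCommGroup B]
  [AddCommGroup X] {π : Γ →* G} {p : ℕ} [Module (ZMod p) J]

/-- The axioms common to Kummer theory (`op` is `x ↦ x ^ p` on `X = M^×`, `B = E^×`) and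
Artin–Schreier theory (`op` is `x ↦ x ^ p - x` on `X = L`, `B = K`): `Γ` acts on `X`, the kernel of
`op` is the line `unity`, on which `Γ` acts through the character `χ`, the fixed points of `π.ker`
are `B`, and `cls` embeds the quotient of `B` by those `b` that are of the form `op b'` into `J`. -/
structure KummerDatum (π : Γ →* G) (ρ : Representation (ZMod p) G J) (B X : Type*)
    [AddCommGroup B] [AddCommGroup X] where
  act : Γ →* AddMonoid.End X
  actBase : G →* AddMonoid.End B
  χ : G →* (ZMod p)ˣ
  op : X →+ X
  incl : B →+ X
  cls : B →+ J
  unity : ZMod p →+ X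
  op_act : ∀ τ x, op (act τ x) = act τ (op x)
  act_incl : ∀ τ b, act τ (incl b) = incl (actBase (π τ) b)
  act_unity : ∀ τ c, act τ (unity c) = unity (χ (π τ) * c)
  cls_actBase : ∀ g b, cls (actBase g b) = ρ g (cls b)
  mem_range_incl : ∀ x, (∀ σ ∈ π.ker, act σ x = x) → x ∈ incl.range
  unity_injective : Function.Injective unity
  ker_op : op.ker = unity.range
  cls_eq_zero_iff : ∀ b, cls b = 0 ↔ ∃ b', op (incl b') = incl b

namespace KummerDatum

variable {ρ : Representation (ZMod p) G J} (D : KummerDatum π ρ B X)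

/-- `x` is a `p`-th root of `γ`, resp. a root of `X ^ p - X - γ`. -/
def IsRoot (γ : J) (x : X) : Prop := ∃ b, D.cls b = γ ∧ D.op x = D.incl b

theorem act_incl_of_mem_ker {σ : Γ} (hσ : σ ∈ π.ker) (b : B) : D.act σ (D.incl b) = D.incl b := by
  rw [D.act_incl, MonoidHom.mem_ker.1 hσ, map_one, AddMonoid.End.one_apply]

theorem act_unity_of_mem_ker {σ : Γ} (hσ : σ ∈ π.ker) (c : ZMod p) :
    D.act σ (D.unity c) = D.unity c := by
  rw [D.act_unity, MonoidHom.mem_ker.1 hσ, map_one, Units.val_one, one_mul]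

variable {D} {γ γ' : J} {x y : X}

theorem IsRoot.add (hx : D.IsRoot γ x) (hy : D.IsRoot γ' y) : D.IsRoot (γ + γ') (x + y) := by
  obtain ⟨b, rfl, hb⟩ := hx
  obtain ⟨b', rfl, hb'⟩ := hy
  exact ⟨b + b', map_add .., by rw [map_add, map_add, hb, hb']⟩

theorem IsRoot.neg (hx : D.IsRoot γ x) : D.IsRoot (-γ) (-x) := by
  obtain ⟨b, rfl, hb⟩ := hx
  exact ⟨-b, map_neg .., by rw [map_neg, map_neg, hb]⟩

theorem IsRoot.act (hx : D.IsRoot γ x) (τ : Γ) : D.IsRoot (ρ (π τ) γ) (D.act τ x) := by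
  obtain ⟨b, rfl, hb⟩ := hx
  exact ⟨_, D.cls_actBase .., by rw [D.op_act, hb, D.act_incl]⟩

theorem IsRoot.exists_unity_eq (hx : D.IsRoot γ x) {σ : Γ} (hσ : σ ∈ π.ker) :
    ∃ c, D.unity c = D.act σ x - x := by
  obtain ⟨b, -, hb⟩ := hx
  rw [← AddMonoidHom.mem_range, ← D.ker_op, AddMonoidHom.mem_ker, map_sub, D.op_act, hb,
    D.act_incl_of_mem_ker hσ, sub_self]

theorem IsRoot.eq_zero_iff (hx : D.IsRoot γ x) : γ = 0 ↔ ∀ σ ∈ π.ker, D.act σ x = x := by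
  obtain ⟨b, rfl, hb⟩ := hx
  rw [D.cls_eq_zero_iff]
  constructor
  · rintro ⟨b', hb'⟩ σ hσ
    obtain ⟨c, hc⟩ : x - D.incl b' ∈ D.unity.range := by
      rw [← D.ker_op, AddMonoidHom.mem_ker, map_sub, hb, hb', sub_self]
    rw [← sub_add_cancel x (D.incl b'), ← hc, map_add, D.act_unity_of_mem_ker hσ,
      D.act_incl_of_mem_ker hσ]
  · intro h
    obtain ⟨b', rfl⟩ := D.mem_range_incl x h
    exact ⟨b', hb⟩

theorem IsRoot.act_sub_self_eq (hx : D.IsRoot γ x) (hy : D.IsRoot γ y) {σ : Γ} (hσ : σ ∈ π.ker) :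
    D.act σ x - x = D.act σ y - y := by
  have h : D.act σ (x + -y) = x + -y :=
    (hx.add hy.neg).eq_zero_iff.1 (add_neg_cancel γ) σ hσ
  rw [map_add, map_neg, ← sub_eq_add_neg, ← sub_eq_add_neg] at h
  rw [sub_eq_sub_iff_sub_eq_sub, h]

variable {V : Type*} [AddCommGroup V] [Module (ZMod p) V] {i : V →+ J}

theorem exists_pairing (hroot : ∀ v, ∃ x, D.IsRoot (i v) x) :
    ∃ φ : Additive π.ker →+ Module.Dual (ZMod p) V,
      ∀ σ v x, D.IsRoot (i v) x → D.unity (φ (.ofMul σ) v) = D.act σ x - x := by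
  choose r hr using hroot
  choose c hc using fun (σ : π.ker) v ↦ (hr v).exists_unity_eq σ.2
  have unity_c (σ : π.ker) (v x) (hx : D.IsRoot (i v) x) : D.unity (c σ v) = D.act σ x - x := by
    rw [hc, (hr v).act_sub_self_eq hx σ.2]
  have c_add (σ v w) : c σ (v + w) = c σ v + c σ w := by
    apply D.unity_injective
    rw [unity_c σ (v + w) (r v + r w) (by rw [map_add]; exact (hr v).add (hr w)), map_add, map_add,
      hc, hc, add_sub_add_comm]
  have c_mul (σ τ v) : c (σ * τ) v = c σ v + c τ v := by
    apply D.unity_injective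
    rw [add_comm, map_add, hc σ, ← D.act_unity_of_mem_ker σ.2 (c τ v), hc, hc, Subgroup.coe_mul,
      map_mul, AddMonoid.End.coe_mul, Function.comp_apply, map_sub, sub_add_sub_cancel]
  let φ (σ : π.ker) : Module.Dual (ZMod p) V :=
    (AddMonoidHom.mk' (c σ) (c_add σ)).toZModLinearMap p
  exact ⟨AddMonoidHom.mk' (fun σ ↦ φ σ.toMul) fun σ τ ↦ LinearMap.ext (c_mul _ _), unity_c⟩

/-- The Kummer pairing `(σ, v) ↦ σ(x) - x` of `π.ker` with a group `V` over `J`, where `x` is any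
root of the image of `v`; its values are read on the line `unity`. -/
noncomputable def pairing (hroot : ∀ v, ∃ x, D.IsRoot (i v) x) :
    Additive π.ker →+ Module.Dual (ZMod p) V :=
  (exists_pairing hroot).choose

variable (hroot : ∀ v, ∃ x, D.IsRoot (i v) x)

theorem unity_pairing (σ : π.ker) {v : V} (hx : D.IsRoot (i v) x) :
    D.unity (pairing hroot (.ofMul σ) v) = D.act σ x - x :=
  (exists_pairing hroot).choose_spec σ v x hx

theorem pairing_eq_zero_iff (σ : π.ker) {v : V} (hx : D.IsRoot (i v) x) :
    pairing hroot (.ofMul σ) v = 0 ↔ D.act σ x = x := by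
  rw [← map_eq_zero_iff _ D.unity_injective, unity_pairing hroot σ hx, sub_eq_zero]

theorem pairing_injective
    (hfaithful : ∀ σ ∈ π.ker, (∀ v x, D.IsRoot (i v) x → D.act σ x = x) → σ = 1) :
    Function.Injective (pairing hroot) :=
  (injective_iff_map_eq_zero _).2 fun σ hσ ↦ congrArg Additive.ofMul <| Subtype.ext <|
    hfaithful σ.toMul σ.toMul.2 fun v _ hx ↦
      (pairing_eq_zero_iff hroot σ.toMul hx).1 (congrArg (· v) hσ)

theorem pairing_separating (hi : Function.Injective i) (v : V)
    (hv : ∀ σ, pairing hroot σ v = 0) : v = 0 := by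
  obtain ⟨x, hx⟩ := hroot v
  exact (map_eq_zero_iff i hi).1 <| hx.eq_zero_iff.2 fun σ hσ ↦
    (pairing_eq_zero_iff hroot ⟨σ, hσ⟩ hx).1 (hv _)

theorem pairing_conj (τ : Γ) (σ : π.ker) {v w : V} (hw : i w = ρ (π τ) (i v)) :
    pairing hroot (.ofMul (MulAut.conjNormal τ σ)) w =
      D.χ (π τ) * pairing hroot (.ofMul σ) v := by
  obtain ⟨x, hx⟩ := hroot v
  apply D.unity_injective
  rw [← D.act_unity, unity_pairing hroot σ hx, unity_pairing hroot _ (hw ▸ hx.act τ), map_sub,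
    MulAut.conjNormal_apply]
  simp only [← Function.comp_apply (f := D.act _), ← AddMonoid.End.coe_mul, ← map_mul,
    inv_mul_cancel_right]

theorem nonempty_mulEquiv_freeSemidirect [Fact p.Prime] [Finite G] (hπ : Function.Surjective π)
    {k : ℕ} {i : (Fin k → (ZMod p)[G]) →+ J} (hi : Function.Injective i)
    (hig : ∀ g v, i (MonoidAlgebra.of (ZMod p) G g • v) = ρ g (i v))
    (hroot : ∀ v, ∃ x, D.IsRoot (i v) x)
    (hfaithful : ∀ σ ∈ π.ker, (∀ v x, D.IsRoot (i v) x → D.act σ x = x) → σ = 1) :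
    Nonempty (Γ ≃* FreeSemidirect p k G) := by
  have hφ : Function.Surjective (pairing hroot) :=
    dual_surjective_of_separating _ (pairing_separating hroot hi)
  exact nonempty_mulEquiv_freeSemidirect_of_dual hπ D.χ (pairing hroot)
    ⟨pairing_injective hroot hfaithful, hφ⟩
    fun τ σ v ↦ pairing_conj hroot τ σ (hig (π τ) v)

end KummerDatum

end AbstractKummerTheory

section Embedding

variable {G J : Type*} [Group G] [AddCommGroup J] {p k : ℕ} [Module (ZMod p) J]

theorem exists_embedding_of_free {ρ : Representation (ZMod p) G J}
    {N : Submodule (ZMod p)[G] ρ.asModule}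
    (e : Nonempty (N ≃ₗ[(ZMod p)[G]] (Fin k → (ZMod p)[G]))) :
    ∃ i : (Fin k → (ZMod p)[G]) →+ J, Function.Injective i ∧
      (∀ g v, i (MonoidAlgebra.of (ZMod p) G g • v) = ρ g (i v)) ∧
      Set.range i = ρ.asModuleEquiv '' N := by
  obtain ⟨e⟩ := e
  refine ⟨ρ.asModuleEquiv.toAddMonoidHom.comp
    (N.subtype.toAddMonoidHom.comp e.symm.toLinearMap.toAddMonoidHom), ?_, fun g v ↦ ?_, ?_⟩
  · exact ρ.asModuleEquiv.injective.comp (N.injective_subtype.comp e.symm.injective)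
  · change ρ.asModuleEquiv (e.symm (MonoidAlgebra.of (ZMod p) G g • v)) =
      ρ g (ρ.asModuleEquiv (e.symm v))
    rw [map_smul, Submodule.coe_smul, Representation.asModuleEquiv_map_smul,
      Representation.asAlgebraHom_of]
  · ext γ
    constructor
    · rintro ⟨v, rfl⟩
      exact ⟨_, (e.symm v).2, rfl⟩
    · rintro ⟨x, hx, rfl⟩
      exact ⟨e ⟨x, hx⟩, by simp⟩

end Embedding

section Tower

variable {F K L : Type*} [Field F] [Field K] [Field L] [Algebra K L] [Algebra F L]

theorem eq_one_of_adjoin_eq_top {S : Set L} (hS : IntermediateField.adjoin K S = ⊤)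
    {σ : Gal(L/F)} (hK : ∀ x, σ (algebraMap K L x) = algebraMap K L x) (hσ : ∀ x ∈ S, σ x = x) :
    σ = 1 := by
  have h : Set.EqOn (σ : L →+* L) (RingHom.id L) (IntermediateField.adjoin K S) :=
    RingHom.eqOn_field_closure <| Set.eqOn_union.2 ⟨Set.forall_mem_range.2 hK, hσ⟩
  exact AlgEquiv.ext fun x ↦ h (hS.ge IntermediateField.mem_top)

variable [Algebra F K] [IsScalarTower F K L] [Normal F K]

theorem mem_ker_restrictNormalHom_iff {σ : Gal(L/F)} :
    σ ∈ (AlgEquiv.restrictNormalHom K).ker ↔ ∀ x, σ (algebraMap K L x) = algebraMap K L x := by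
  rw [MonoidHom.mem_ker, AlgEquiv.ext_iff]
  refine forall_congr' fun x ↦ ?_
  rw [← (algebraMap K L).injective.eq_iff]
  exact Iff.of_eq (congrArg (· = _) (σ.restrictNormal_commutes K x))

theorem restrictScalars_mem_ker_restrictNormalHom (f : Gal(L/K)) :
    AlgEquiv.restrictScalars F f ∈ (AlgEquiv.restrictNormalHom K).ker :=
  mem_ker_restrictNormalHom_iff.2 f.commutes

end Tower

section ArtinSchreierTheory

variable (p : ℕ) [Fact p.Prime] (F K L : Type*) [Field F] [Field K] [Field L] [Algebra F K]
  [Algebra K L] [Algebra F L] [IsScalarTower F K L] [CharP K p]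

theorem ker_wp [CharP L p] :
    (wp p L).ker = (ZMod.castHom dvd_rfl L : ZMod p →+* L).toAddMonoidHom.range := by
  ext x
  rw [AddMonoidHom.mem_ker, show wp p L x = x ^ p - x from rfl, sub_eq_zero,
    ← Subfield.mem_bot_iff_pow_eq_self (F := L) (p := p), ← ZMod.fieldRange_castHom_eq_bot p]
  rfl

/-- Artin–Schreier theory for `L/K`. -/
noncomputable def artinSchreierDatum [Normal F K] [IsGalois K L] [CharP L p] :
    KummerDatum (AlgEquiv.restrictNormalHom K : Gal(L/F) →* Gal(K/F)) (asRep p F K) K L where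
  act := DistribMulAction.toAddMonoidEnd Gal(L/F) L
  actBase := DistribMulAction.toAddMonoidEnd Gal(K/F) K
  χ := 1
  op := wp p L
  incl := algebraMap K L
  cls := QuotientAddGroup.mk' _
  unity := ZMod.castHom dvd_rfl L
  op_act τ x := show τ x ^ p - τ x = τ (x ^ p - x) by rw [map_sub, map_pow]
  act_incl τ b := (τ.restrictNormal_commutes K b).symm
  act_unity τ c := by
    rw [MonoidHom.one_apply, Units.val_one, one_mul]
    exact DFunLike.congr_fun
      (Subsingleton.elim ((τ : L →+* L).comp (ZMod.castHom dvd_rfl L)) (ZMod.castHom dvd_rfl L)) c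
  cls_actBase g b := rfl
  mem_range_incl x hx := by
    refine (InfiniteGalois.mem_range_algebraMap_iff_fixed x).2 fun f ↦ ?_
    exact hx _ (restrictScalars_mem_ker_restrictNormalHom f)
  unity_injective := (ZMod.castHom dvd_rfl L).injective
  ker_op := ker_wp p L
  cls_eq_zero_iff b := by
    refine (QuotientAddGroup.eq_zero_iff b).trans (exists_congr fun b' ↦ ?_)
    change b' ^ p - b' = b ↔ algebraMap K L b' ^ p - algebraMap K L b' = algebraMap K L b
    rw [← map_pow, ← map_sub, (algebraMap K L).injective.eq_iff]

variable {F K L}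

theorem nonempty_mulEquiv_of_isASExtOf [Finite Gal(K/F)] [Normal F K] [IsGalois F L]
    {k : ℕ} {N : Submodule (ZMod p)[Gal(K/F)] (asRep p F K).asModule}
    (hN : IsASExtOf p L ((asRep p F K).asModuleEquiv '' (N : Set (asRep p F K).asModule)))
    (e : Nonempty (N ≃ₗ[(ZMod p)[Gal(K/F)]] (Fin k → (ZMod p)[Gal(K/F)]))) :
    Nonempty (Gal(L/F) ≃* FreeSemidirect p k Gal(K/F)) := by
  have := IsGalois.tower_top_of_isGalois F K L
  have := charP_of_injective_algebraMap (algebraMap K L).injective p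
  obtain ⟨i, hi, hig, hiN⟩ := exists_embedding_of_free e
  rw [← hiN] at hN
  refine (artinSchreierDatum p F K L).nonempty_mulEquiv_freeSemidirect
    (AlgEquiv.restrictNormalHom_surjective L) hi hig (fun v ↦ ?_) fun σ hσ h ↦ ?_
  · obtain ⟨a, ha⟩ := QuotientAddGroup.mk_surjective (i v)
    obtain ⟨x, hx⟩ := hN.1 a ⟨v, ha.symm⟩
    exact ⟨x, a, ha, hx⟩
  · refine eq_one_of_adjoin_eq_top hN.2 (mem_ker_restrictNormalHom_iff.1 hσ) ?_
    rintro x ⟨a, ⟨v, hv⟩, hx⟩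
    exact h v x ⟨a, hv.symm, hx⟩

end ArtinSchreierTheory

section KummerExtensions

section Unity

variable {p : ℕ} {R : Type*} [CommRing R] {ζ : Rˣ}

/-- The parametrization `c ↦ ζ ^ c` of the powers of a primitive `p`-th root of unity. -/
noncomputable def unityHom (hζ : IsPrimitiveRoot ζ p) : ZMod p →+ Additive Rˣ :=
  (Subgroup.zpowers ζ).subtype.toAdditive.comp hζ.zmodEquivZPowers.toAddMonoidHom

theorem unityHom_natCast (hζ : IsPrimitiveRoot ζ p) (n : ℕ) :
    unityHom hζ n = .ofMul (ζ ^ n) := by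
  simp [unityHom]

theorem unityHom_injective (hζ : IsPrimitiveRoot ζ p) : Function.Injective (unityHom hζ) :=
  Subtype.val_injective.comp hζ.zmodEquivZPowers.injective

theorem toAdditive_unityHom [NeZero p] (hζ : IsPrimitiveRoot ζ p) {f : Rˣ →* Rˣ} {a : ZMod p}
    (hf : f ζ = ζ ^ a.val) (c : ZMod p) :
    f.toAdditive (unityHom hζ c) = unityHom hζ (a * c) := by
  obtain ⟨n, rfl⟩ := ZMod.natCast_zmod_surjective c
  rw [← ZMod.natCast_zmod_val a, ← Nat.cast_mul, unityHom_natCast, unityHom_natCast, pow_mul, ← hf,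
    ← map_pow]
  rfl

theorem range_unityHom [NeZero p] [IsDomain R] (hζ : IsPrimitiveRoot ζ p) :
    (unityHom hζ).range = (powMonoidHom p : Rˣ →* Rˣ).toAdditive.ker := by
  ext x
  change (∃ c, ((hζ.zmodEquivZPowers c).toMul : Rˣ) = x.toMul) ↔ x.toMul ^ p = 1
  rw [← mem_rootsOfUnity, ← hζ.zpowers_eq]
  exact ⟨fun ⟨c, hc⟩ ↦ hc ▸ (hζ.zmodEquivZPowers c).toMul.2, fun hx ↦
    ⟨hζ.zmodEquivZPowers.symm (.ofMul ⟨_, hx⟩), by simp⟩⟩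

end Unity

/-- The action of `G` on the Kummer classes of `E` through a homomorphism `c` to `Gal(E/F)`, such
as a lift to `E = K(ξ_p)` of the action of `Gal(K/F)` on `K`. -/
def powerRepAlong (p : ℕ) {G F E : Type*} [Group G] [Field F] [Field E] [Algebra F E]
    (c : G →* Gal(E/F)) : Representation (ZMod p) G (PowerClasses p E) :=
  (powerRep p F E).comp c

variable {p : ℕ} [Fact p.Prime] {Γ G F E M : Type*} [Group Γ] [Group G] [Field F] [Field E]
  [Field M] [Algebra F E] [Algebra F M] [Algebra E M] {π : Γ →* G}

variable (F E) in
/-- The action of `Gal(E/F)` on `E^×`, written additively. -/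
def unitsAction : Gal(E/F) →* AddMonoid.End (Additive Eˣ) :=
  (monoidEndToAdditive Eˣ).toMonoidHom.comp (MulDistribMulAction.toMonoidEnd Gal(E/F) Eˣ)

/-- Kummer theory for `M/E`, where `Γ` acts on `M` compatibly with the action of its quotient `G`
on `E`. -/
noncomputable def kummerDatum {ξ : Eˣ} (hξ : IsPrimitiveRoot ξ p) (l : Γ →* Gal(M/F))
    (c : G →* Gal(E/F)) (hlc : ∀ τ b, l τ (algebraMap E M b) = algebraMap E M (c (π τ) b))
    (hfix : ∀ x, (∀ σ ∈ π.ker, l σ x = x) → x ∈ (algebraMap E M).range) :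
    KummerDatum π (powerRepAlong p c) (Additive Eˣ) (Additive Mˣ) where
  act := (unitsAction F M).comp l
  actBase := (unitsAction F E).comp c
  χ := ((IsPrimitiveRoot.coe_units_iff.2 hξ).autToPow F).comp c
  op := (powMonoidHom p).toAdditive
  incl := (Units.map (algebraMap E M)).toAdditive
  cls := (QuotientGroup.mk' (powMonoidHom p : Eˣ →* Eˣ).range).toAdditive
  unity := unityHom (hξ.map_of_injective (Units.map_injective (algebraMap E M).injective))
  op_act τ x := (map_pow (Units.map (l τ : M →* M)) x.toMul p).symm
  act_incl τ b := Units.ext (hlc τ b.toMul)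
  act_unity τ := toAdditive_unityHom _ <| Units.ext <| (hlc τ ξ).trans <| by
    rw [← IsPrimitiveRoot.autToPow_spec F (IsPrimitiveRoot.coe_units_iff.2 hξ), map_pow]
    rfl
  cls_actBase _ _ := rfl
  mem_range_incl x hx := by
    obtain ⟨b, hb⟩ := hfix x.toMul fun σ hσ ↦ congrArg Units.val (hx σ hσ)
    have hb0 : b ≠ 0 := by
      rintro rfl
      exact x.toMul.ne_zero (hb.symm.trans (map_zero _))
    exact ⟨.ofMul (Units.mk0 b hb0), Units.ext hb⟩
  unity_injective := unityHom_injective _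
  ker_op := (range_unityHom _).symm
  cls_eq_zero_iff b := by
    refine (QuotientGroup.eq_one_iff b.toMul).trans (exists_congr fun b' ↦ ?_)
    rw [← (Units.map_injective (algebraMap E M).injective).eq_iff, powMonoidHom_apply, map_pow]
    rfl

theorem nonempty_mulEquiv_of_isKummerExtOf [Finite G] (hπ : Function.Surjective π)
    {ξ : Eˣ} (hξ : IsPrimitiveRoot ξ p) {l : Γ →* Gal(M/F)} (hl : Function.Injective l)
    {c : G →* Gal(E/F)} (hlc : ∀ τ b, l τ (algebraMap E M b) = algebraMap E M (c (π τ) b))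
    (hfix : ∀ x, (∀ σ ∈ π.ker, l σ x = x) → x ∈ (algebraMap E M).range) {k : ℕ}
    {i : (Fin k → (ZMod p)[G]) →+ PowerClasses p E} (hi : Function.Injective i)
    (hig : ∀ g v, i (MonoidAlgebra.of (ZMod p) G g • v) = powerRepAlong p c g (i v))
    (hM : IsKummerExtOf p M (Set.range i)) :
    Nonempty (Γ ≃* FreeSemidirect p k G) := by
  have hunit {u : Eˣ} {x : M} (hx : x ^ p = algebraMap E M u) : IsUnit x :=
    (isUnit_pow_iff (NeZero.ne p)).1 (hx ▸ u.isUnit.map _)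
  refine (kummerDatum hξ l c hlc hfix).nonempty_mulEquiv_freeSemidirect hπ hi hig
    (fun v ↦ ?_) fun σ hσ h ↦ ?_
  · obtain ⟨u, hu⟩ := PowerClasses.mk_surjective p (i v)
    obtain ⟨x, hx⟩ := hM.1 u ⟨v, hu.symm⟩
    obtain ⟨y, rfl⟩ := hunit hx
    exact ⟨.ofMul y, .ofMul u, hu, Units.ext hx⟩
  · have hσE (x) : l σ (algebraMap E M x) = algebraMap E M x := by
      rw [hlc, MonoidHom.mem_ker.1 hσ, map_one, AlgEquiv.one_apply]
    refine (map_eq_one_iff l hl).1 (eq_one_of_adjoin_eq_top hM.2 hσE ?_)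
    rintro x ⟨u, ⟨v, hv⟩, hx⟩
    obtain ⟨y, rfl⟩ := hunit hx
    exact congrArg Units.val (h v (.ofMul y) ⟨.ofMul u, hv.symm, Units.ext hx⟩)

end KummerExtensions

section CyclotomicTower

variable (p : ℕ) [Fact p.Prime] {F K L E M : Type*} [Field F] [Field K] [Field L] [Field E]
  [Field M] [Algebra F M] [Algebra L M]

theorem exists_isPrimitiveRoot_units (p : ℕ) [NeZero p] (K E : Type*) [Field K] [Field E]
    [Algebra K E] [IsCyclotomicExtension {p} K E] : ∃ ξ : Eˣ, IsPrimitiveRoot ξ p := by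
  obtain ⟨ξ, hξ⟩ := IsCyclotomicExtension.exists_isPrimitiveRoot (S := {p}) K E
    (Set.mem_singleton p) (NeZero.ne p)
  exact ⟨_, hξ.isUnit_unit (NeZero.ne p)⟩

theorem isGalois_of_isCyclotomicExtension [Algebra F L] [IsScalarTower F L M] [IsGalois F L]
    [IsCyclotomicExtension {p} L M] : IsGalois F M := by
  obtain ⟨ξ, hξ⟩ := exists_isPrimitiveRoot_units p L M
  have hζ : IsPrimitiveRoot (ξ : M) p := IsPrimitiveRoot.coe_units_iff.2 hξ
  have : Algebra.IsIntegral L M := IsCyclotomicExtension.integral {p} L M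
  have : Algebra.IsIntegral F M := Algebra.IsIntegral.trans L
  have := hζ.intermediateField_adjoin_isCyclotomicExtension F
  have : IsGalois F (IntermediateField.adjoin F {(ξ : M)}) :=
    IsCyclotomicExtension.isGalois {p} F _
  let L' := (IsScalarTower.toAlgHom F L M).fieldRange
  have : IsGalois F L' :=
    IsGalois.of_algEquiv (AlgEquiv.ofInjectiveField (IsScalarTower.toAlgHom F L M))
  have hsup : L' ⊔ IntermediateField.adjoin F {(ξ : M)} = ⊤ := by
    rw [eq_top_iff]
    rintro x -
    have hx := IsCyclotomicExtension.adjoin_roots (S := {p}) (A := L) (B := M) x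
    induction hx using Algebra.adjoin_induction with
    | mem y hy =>
      obtain ⟨_, rfl, -, hy⟩ := hy
      obtain ⟨i, -, rfl⟩ := hζ.eq_pow_of_pow_eq_one hy
      exact le_sup_right (a := L') (pow_mem (IntermediateField.mem_adjoin_simple_self F _) i)
    | algebraMap a => exact le_sup_left (a := L') ⟨a, rfl⟩
    | add a b _ _ ha hb => exact add_mem ha hb
    | mul a b _ _ ha hb => exact mul_mem ha hb
  have : IsGalois F (L' ⊔ IntermediateField.adjoin F {(ξ : M)} : IntermediateField F M) :=
    { to_isSeparable := IntermediateField.isSeparable_sup F M _ _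
      to_normal := IntermediateField.normal_sup F M _ _ }
  rw [hsup] at this
  exact IsGalois.of_algEquiv IntermediateField.topEquiv

theorem pow_prime_eq_self_of_isCyclotomicExtension [Algebra K E] [IsCyclotomicExtension {p} K E]
    (σ : Gal(E/K)) : σ ^ p = σ := by
  obtain ⟨ξ, hξ⟩ := exists_isPrimitiveRoot_units p K E
  apply IsPrimitiveRoot.autToPow_injective K (IsPrimitiveRoot.coe_units_iff.2 hξ)
  rw [map_pow]
  exact Units.ext (ZMod.pow_card _)

variable [Algebra K E] [Algebra E M] [IsCyclotomicExtension {p} K E]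

/-- As `Gal(L/K)` has exponent `p` and `Gal(E/K)` has exponent dividing `p - 1`, the automorphism
`v * (v ^ p)⁻¹` agrees with `v` on `L` and is trivial on `E`. -/
theorem exists_restrictNormalHom_eq_and_eq_one [Algebra K L] [Algebra K M] [IsScalarTower K L M]
    [IsScalarTower K E M] [Normal K L] [Normal K E] (hL : ∀ s : Gal(L/K), s ^ p = 1)
    (v : Gal(M/K)) :
    ∃ w : Gal(M/K), AlgEquiv.restrictNormalHom L w = AlgEquiv.restrictNormalHom L v ∧
      AlgEquiv.restrictNormalHom E w = 1 := by
  refine ⟨v * (v ^ p)⁻¹, ?_, ?_⟩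
  · rw [map_mul, map_inv, map_pow, hL, inv_one, mul_one]
  · rw [map_mul, map_inv, map_pow, pow_prime_eq_self_of_isCyclotomicExtension, mul_inv_cancel]

theorem algEquiv_eq_of_isCyclotomicExtension (p : ℕ) [NeZero p] (K : Type*) [Field K] [Algebra K E]
    [IsCyclotomicExtension {p} K E] [IsCyclotomicExtension {p} L M] {h h' : Gal(M/F)}
    (hL : ∀ a, h (algebraMap L M a) = h' (algebraMap L M a))
    (hE : ∀ b, h (algebraMap E M b) = h' (algebraMap E M b)) : h = h' := by
  obtain ⟨ξ, hξ⟩ := exists_isPrimitiveRoot_units p K E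
  have hζ : IsPrimitiveRoot (algebraMap E M ξ) p :=
    (IsPrimitiveRoot.coe_units_iff.2 hξ).map_of_injective (algebraMap E M).injective
  refine AlgEquiv.ext fun x ↦ ?_
  have hx := IsCyclotomicExtension.adjoin_roots (S := {p}) (A := L) (B := M) x
  induction hx using Algebra.adjoin_induction with
  | mem y hy =>
    obtain ⟨_, rfl, -, hy⟩ := hy
    obtain ⟨i, -, rfl⟩ := hζ.eq_pow_of_pow_eq_one hy
    rw [map_pow, map_pow, hE]
  | algebraMap a => exact hL a
  | add a b _ _ ha hb => rw [map_add, map_add, ha, hb]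
  | mul a b _ _ ha hb => rw [map_mul, map_mul, ha, hb]

variable [Algebra K L] [Algebra K M] [IsScalarTower K L M] [IsScalarTower K E M]
  [IsCyclotomicExtension {p} L M] [Algebra F K] [Algebra F L] [Algebra F E] [IsScalarTower F K L]
  [IsScalarTower F E M] [IsScalarTower F L M] [IsGalois F L]

theorem exists_algEquiv_extends (hL : ∀ s : Gal(L/K), s ^ p = 1) {f : Gal(L/F)} {g : Gal(E/F)}
    (hfg : ∀ x, algebraMap L M (f (algebraMap K L x)) = algebraMap E M (g (algebraMap K E x))) :
    ∃ h : Gal(M/F), (∀ a, h (algebraMap L M a) = algebraMap L M (f a)) ∧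
      ∀ b, h (algebraMap E M b) = algebraMap E M (g b) := by
  have : IsGalois F M := isGalois_of_isCyclotomicExtension p (L := L)
  have : IsScalarTower F K M := IsScalarTower.to₁₂₄ F K L M
  have : IsGalois K L := IsGalois.tower_top_of_isGalois F K L
  have : Normal K E := (IsCyclotomicExtension.isGalois {p} K E).to_normal
  let f' := f.liftNormal M
  let g' := g.liftNormal M
  let v : Gal(M/K) := AlgEquiv.ofRingEquiv (f := (g'⁻¹ * f').toRingEquiv) fun x ↦ by
    change g'.symm (f' (algebraMap K M x)) = algebraMap K M x
    rw [AlgEquiv.symm_apply_eq, IsScalarTower.algebraMap_apply K L M, f.liftNormal_commutes, hfg,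
      ← IsScalarTower.algebraMap_apply, IsScalarTower.algebraMap_apply K E M,
      g.liftNormal_commutes]
  obtain ⟨w, hwL, hwE⟩ := exists_restrictNormalHom_eq_and_eq_one p (E := E) hL v
  refine ⟨g' * w.restrictScalars F, fun a ↦ ?_, fun b ↦ ?_⟩
  · have h : w (algebraMap L M a) = v (algebraMap L M a) := by
      rw [← w.restrictNormal_commutes L, ← v.restrictNormal_commutes L]
      exact congrArg (algebraMap L M) (DFunLike.congr_fun hwL a)
    change g' (w (algebraMap L M a)) = _
    rw [h, ← f.liftNormal_commutes M]
    exact g'.apply_symm_apply _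
  · have h : w (algebraMap E M b) = algebraMap E M b := by
      rw [← w.restrictNormal_commutes E]
      exact congrArg (algebraMap E M) (DFunLike.congr_fun hwE b)
    change g' (w (algebraMap E M b)) = _
    rw [h, g.liftNormal_commutes]

variable [Normal F K]

theorem exists_galoisHom_extends (hL : ∀ s : Gal(L/K), s ^ p = 1) {c : Gal(K/F) →* Gal(E/F)}
    (hc : ∀ g x, c g (algebraMap K E x) = algebraMap K E (g x)) :
    ∃ l : Gal(L/F) →* Gal(M/F),
      (∀ τ a, l τ (algebraMap L M a) = algebraMap L M (τ a)) ∧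
      ∀ τ b, l τ (algebraMap E M b) =
        algebraMap E M (c (AlgEquiv.restrictNormalHom K τ) b) := by
  have h (τ : Gal(L/F)) := exists_algEquiv_extends p (M := M) hL
    (f := τ) (g := c (AlgEquiv.restrictNormalHom K τ)) fun x ↦ by
      rw [hc, ← IsScalarTower.algebraMap_apply, IsScalarTower.algebraMap_apply K L M]
      exact congrArg _ (τ.restrictNormal_commutes K x).symm
  choose l hlL hlE using h
  refine ⟨MonoidHom.mk' l fun τ τ' ↦ ?_, hlL, hlE⟩
  refine algEquiv_eq_of_isCyclotomicExtension p K (L := L) (E := E) (fun a ↦ ?_) fun b ↦ ?_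
  · rw [hlL, AlgEquiv.mul_apply, AlgEquiv.mul_apply, hlL, hlL]
  · rw [hlE, map_mul, map_mul, AlgEquiv.mul_apply, AlgEquiv.mul_apply, hlE, hlE]

theorem mem_range_algebraMap_of_galoisHom (p : ℕ) [Fact p.Prime] [IsCyclotomicExtension {p} K E]
    [IsCyclotomicExtension {p} L M] {c : Gal(K/F) →* Gal(E/F)}
    {l : Gal(L/F) →* Gal(M/F)}
    (hlL : ∀ τ a, l τ (algebraMap L M a) = algebraMap L M (τ a))
    (hlE : ∀ τ b, l τ (algebraMap E M b) = algebraMap E M (c (AlgEquiv.restrictNormalHom K τ) b))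
    {x : M} (hx : ∀ σ ∈ (AlgEquiv.restrictNormalHom K : Gal(L/F) →* _).ker, l σ x = x) :
    x ∈ (algebraMap E M).range := by
  have : IsGalois F M := isGalois_of_isCyclotomicExtension p (L := L)
  have : IsGalois E M := IsGalois.tower_top_of_isGalois F E M
  refine (InfiniteGalois.mem_range_algebraMap_iff_fixed x).2 fun f ↦ ?_
  let f' := f.restrictScalars F
  have hf' : AlgEquiv.restrictNormalHom L f' ∈
      (AlgEquiv.restrictNormalHom K : Gal(L/F) →* _).ker := by
    refine mem_ker_restrictNormalHom_iff.2 fun x ↦ (algebraMap L M).injective ?_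
    refine (f'.restrictNormal_commutes L _).trans ?_
    rw [← IsScalarTower.algebraMap_apply, IsScalarTower.algebraMap_apply K E M]
    exact f.commutes _
  suffices l (AlgEquiv.restrictNormalHom L f') = f' by
    exact (DFunLike.congr_fun this x).symm.trans (hx _ hf')
  refine algEquiv_eq_of_isCyclotomicExtension p K (L := L) (E := E) (fun a ↦ ?_) fun b ↦ ?_
  · exact (hlL _ a).trans (f'.restrictNormal_commutes L a)
  · rw [hlE, MonoidHom.mem_ker.1 hf', map_one, AlgEquiv.one_apply]
    exact (f.commutes b).symm

end CyclotomicTower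

section Submodules

variable {p : ℕ} [Fact p.Prime] {n : ℕ} {F K : Type*} (E : Type*) [Field F] [Field K] [Field E]
  [Algebra F K] [Algebra F E] [Algebra K E] [IsScalarTower F K E] [FiniteDimensional F K]
  [IsGalois F K] [IsCyclotomicExtension {p} K E]

theorem exists_linearEquiv_submodule_powerRep
    (hG : Nonempty (Gal(K/F) ≃* Multiplicative (ZMod (p ^ n))))
    (N : Submodule (ZMod p)[Gal(K/F)] (cycRep p E hG).asModule) :
    ∃ N' : Submodule (ZMod p)[Gal(K/F)] (powerRepAlong p (cycLift p E hG)).asModule,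
      (powerRepAlong p (cycLift p E hG)).asModuleEquiv '' N' =
        (fun x ↦ ((cycRep p E hG).asModuleEquiv x : PowerClasses p E)) '' N ∧
      Nonempty (N ≃ₗ[(ZMod p)[Gal(K/F)]] N') := by
  let i : (cycRep p E hG).asModule →ₗ[(ZMod p)[Gal(K/F)]]
      (powerRepAlong p (cycLift p E hG)).asModule :=
    Representation.IntertwiningMap.equivLinearMapAsModule _ _
      ⟨(cycSpace p K E).subtype, fun _ ↦ rfl⟩
  refine ⟨N.map i, ?_, ⟨Submodule.equivMapOfInjective i Subtype.val_injective N⟩⟩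
  rw [Submodule.map_coe, Set.image_image]
  rfl

end Submodules

section ElementaryAbelianExtensions

variable {p : ℕ} [Fact p.Prime] {k : ℕ} {F K L : Type*} [Field F] [Field K] [Field L]
  [Algebra F K] [Algebra K L] [Algebra F L] [IsScalarTower F K L] [Finite Gal(K/F)] [Normal F K]
  [IsGalois F L]

theorem nonempty_mulEquiv_of_isPrimitiveRoot {ξ : K} (hξ : IsPrimitiveRoot ξ p)
    {N : Submodule (ZMod p)[Gal(K/F)] (powerRep p F K).asModule}
    (hN : IsKummerExtOf p L ((powerRep p F K).asModuleEquiv '' (N : Set (powerRep p F K).asModule)))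
    (e : Nonempty (N ≃ₗ[(ZMod p)[Gal(K/F)]] (Fin k → (ZMod p)[Gal(K/F)]))) :
    Nonempty (Gal(L/F) ≃* FreeSemidirect p k Gal(K/F)) := by
  have := IsGalois.tower_top_of_isGalois F K L
  obtain ⟨i, hi, hig, hiN⟩ := exists_embedding_of_free e
  exact nonempty_mulEquiv_of_isKummerExtOf (AlgEquiv.restrictNormalHom_surjective L)
    (hξ.isUnit_unit (NeZero.ne p)) (F := F) (l := MonoidHom.id _) Function.injective_id
    (c := MonoidHom.id _) (fun τ b ↦ (τ.restrictNormal_commutes K b).symm)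
    (fun x hx ↦ (InfiniteGalois.mem_range_algebraMap_iff_fixed x).2 fun f ↦
      hx _ (restrictScalars_mem_ker_restrictNormalHom f)) hi hig (hiN ▸ hN)

theorem nonempty_mulEquiv_of_isCyclotomicExtension (hL : ∀ s : Gal(L/K), s ^ p = 1)
    {E M : Type*} [Field E] [Field M] [Algebra F E] [Algebra K E] [IsScalarTower F K E]
    [IsCyclotomicExtension {p} K E] [Algebra K M] [Algebra L M] [Algebra E M]
    [IsScalarTower K L M] [IsScalarTower K E M] [IsCyclotomicExtension {p} L M]
    {c : Gal(K/F) →* Gal(E/F)} (hc : ∀ g x, c g (algebraMap K E x) = algebraMap K E (g x))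
    {N : Submodule (ZMod p)[Gal(K/F)] (powerRepAlong p c).asModule}
    (hN : IsKummerExtOf p M ((powerRepAlong p c).asModuleEquiv ''
      (N : Set (powerRepAlong p c).asModule)))
    (e : Nonempty (N ≃ₗ[(ZMod p)[Gal(K/F)]] (Fin k → (ZMod p)[Gal(K/F)]))) :
    Nonempty (Gal(L/F) ≃* FreeSemidirect p k Gal(K/F)) := by
  let _ : Algebra F M := ((algebraMap K M).comp (algebraMap F K)).toAlgebra
  have : IsScalarTower F K M := .of_algebraMap_eq fun _ ↦ rfl
  have : IsScalarTower F L M := .to₁₃₄ F K L M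
  have : IsScalarTower F E M := .to₁₃₄ F K E M
  obtain ⟨ξ, hξ⟩ := exists_isPrimitiveRoot_units p K E
  obtain ⟨l, hlL, hlE⟩ := exists_galoisHom_extends p (M := M) hL hc
  have hl : Function.Injective l := fun τ τ' h ↦ AlgEquiv.ext fun a ↦
    (algebraMap L M).injective <| by rw [← hlL, h, hlL]
  obtain ⟨i, hi, hig, hiN⟩ := exists_embedding_of_free e
  exact nonempty_mulEquiv_of_isKummerExtOf (AlgEquiv.restrictNormalHom_surjective L) hξ hl hlE
    (fun _ ↦ mem_range_algebraMap_of_galoisHom p hlL hlE) hi hig (hiN ▸ hN)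

end ElementaryAbelianExtensions

theorem lemma4p1_general (p : ℕ) [Fact p.Prime] (k : ℕ) (F K L : Type*) [Field F] [Field K]
    [Field L] [Algebra F K] [Algebra K L] [Algebra F L] [IsScalarTower F K L] [Finite Gal(K/F)]
    [Normal F K] [IsGalois F L] :
    ((∃ ξ : K, IsPrimitiveRoot ξ p) →
      ∀ N : Submodule (ZMod p)[Gal(K/F)] (powerRep p F K).asModule,
        IsKummerExtOf p L ((powerRep p F K).asModuleEquiv '' (N : Set (powerRep p F K).asModule)) →
        Nonempty (N ≃ₗ[(ZMod p)[Gal(K/F)]] (Fin k → (ZMod p)[Gal(K/F)])) →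
        Nonempty (Gal(L/F) ≃* FreeSemidirect p k Gal(K/F))) ∧
    ((∀ s : Gal(L/K), s ^ p = 1) →
      ∀ (E M : Type*) [Field E] [Field M] [Algebra F E] [Algebra K E] [IsScalarTower F K E]
        [IsCyclotomicExtension {p} K E] [Algebra K M] [Algebra L M] [Algebra E M]
        [IsScalarTower K L M] [IsScalarTower K E M] [IsCyclotomicExtension {p} L M]
        (c : Gal(K/F) →* Gal(E/F)),
      (∀ g x, c g (algebraMap K E x) = algebraMap K E (g x)) →
      ∀ N : Submodule (ZMod p)[Gal(K/F)] (powerRepAlong p c).asModule,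
        IsKummerExtOf p M ((powerRepAlong p c).asModuleEquiv ''
          (N : Set (powerRepAlong p c).asModule)) →
        Nonempty (N ≃ₗ[(ZMod p)[Gal(K/F)]] (Fin k → (ZMod p)[Gal(K/F)])) →
        Nonempty (Gal(L/F) ≃* FreeSemidirect p k Gal(K/F))) ∧
    (∀ [CharP K p], ∀ N : Submodule (ZMod p)[Gal(K/F)] (asRep p F K).asModule,
        IsASExtOf p L ((asRep p F K).asModuleEquiv '' (N : Set (asRep p F K).asModule)) →
        Nonempty (N ≃ₗ[(ZMod p)[Gal(K/F)]] (Fin k → (ZMod p)[Gal(K/F)])) →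
        Nonempty (Gal(L/F) ≃* FreeSemidirect p k Gal(K/F))) :=
  ⟨fun ⟨_, hξ⟩ _ hN e ↦ nonempty_mulEquiv_of_isPrimitiveRoot hξ hN e,
    fun hL _ _ _ _ _ _ _ _ _ _ _ _ _ _ _ hc _ hN e ↦
      nonempty_mulEquiv_of_isCyclotomicExtension hL hc hN e,
    fun _ hN e ↦ nonempty_mulEquiv_of_isASExtOf p hN e⟩

theorem lemma4p1 {p n : ℕ} [Fact p.Prime] (hn : 0 < n) (hn2 : p = 2 → 2 ≤ n) (k : ℕ)
    {F K L : Type*} [Field F] [Field K] [Field L] [Algebra F K] [Algebra K L] [Algebra F L]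
    [IsScalarTower F K L]
    -- `K / F` is a `G`-extension, with `G = ℤ/p^n`
    [FiniteDimensional F K] [IsGalois F K]
    (hG : Nonempty (Gal(K/F) ≃* Multiplicative (ZMod (p ^ n))))
    -- `L / K` is elementary `p`-abelian and Galois over `F`
    (hL : IsElementaryAbelianExt p K L) [IsGalois F L] :
    -- `ξ_p ∈ K`: `J = K^× / K^{×p}` and `L = K(γ^{1/p} : γ ∈ N)`
    ((∃ ξ : K, IsPrimitiveRoot ξ p) →
      ∀ N : Submodule (ZMod p)[Gal(K/F)] (powerRep p F K).asModule,
        IsKummerExtOf p L ((powerRep p F K).asModuleEquiv '' (N : Set (powerRep p F K).asModule)) →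
        Nonempty (N ≃ₗ[(ZMod p)[Gal(K/F)]] (Fin k → (ZMod p)[Gal(K/F)])) →
        Nonempty (Gal(L/F) ≃* FreeSemidirect p k Gal(K/F))) ∧
    -- `char K ≠ p`: `J ⊆ E^× / E^{×p}` with `E = K(ξ_p)`, and `L(ξ_p) = E(γ^{1/p} : γ ∈ N)`
    ((p : K) ≠ 0 →
      ∀ (E M : Type*) [Field E] [Field M] [Algebra F E] [Algebra K E] [IsScalarTower F K E]
        [IsCyclotomicExtension {p} K E] [Algebra K M] [Algebra L M] [Algebra E M]
        [IsScalarTower K L M] [IsScalarTower K E M] [IsCyclotomicExtension {p} L M],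
      ∀ N : Submodule (ZMod p)[Gal(K/F)] (cycRep p E hG).asModule,
        IsKummerExtOf p M ((fun x => ((cycRep p E hG).asModuleEquiv x : PowerClasses p E)) ''
          (N : Set (cycRep p E hG).asModule)) →
        Nonempty (N ≃ₗ[(ZMod p)[Gal(K/F)]] (Fin k → (ZMod p)[Gal(K/F)])) →
        Nonempty (Gal(L/F) ≃* FreeSemidirect p k Gal(K/F))) ∧
    -- `char K = p`: `J = K / ℘(K)` and `L = K(ρ(γ) : γ ∈ N)`
    (∀ [CharP K p], ∀ N : Submodule (ZMod p)[Gal(K/F)] (asRep p F K).asModule,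
        IsASExtOf p L ((asRep p F K).asModuleEquiv '' (N : Set (asRep p F K).asModule)) →
        Nonempty (N ≃ₗ[(ZMod p)[Gal(K/F)]] (Fin k → (ZMod p)[Gal(K/F)])) →
        Nonempty (Gal(L/F) ≃* FreeSemidirect p k Gal(K/F))) := by
  refine (lemma4p1_general p k F K L).imp_right
    (And.imp_left fun h _ E M _ _ _ _ _ _ _ _ _ _ _ _ N hN e ↦ ?_)
  obtain ⟨N', hN', ⟨e'⟩⟩ := exists_linearEquiv_submodule_powerRep E hG N
  exact h hL.pow_eq_one E M (cycLift p E hG) (fun g ↦ (cycLift_spec p E hG g).1) N' (hN' ▸ hN)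
    (e.map e'.symm.trans)
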